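/- **Setting.** Let $K$ be a complete discretely valued field of characteristic $0$ with finite residue field of $q$ elements and characteristic $p$, $R$ its ring of integers, $\pi$ a uniformizer, $|\pi|=1/p$, and write $|a|=p^{-\operatorname{ord}_\pi a}$. Fix $n\ge 1$. Let $A_0$ be the ring of power series $\sum_{u\in\mathbf Z_{\ge0}^n}a_uX^u$ with $a_u\in R$, $a_u\to0$, with the Gauss norm $\|\cdot\|$; let $A\subset A_0$ be the subring of overconvergent series, those with $\liminf_{|u|\to\infty}\operatorname{ord}_\pi(a_u)/|u|>0$. Let $\sigma$ be an $R$-algebra endomorphism of $A_0$ with $\sigma(A)\subset A$ and $\sigma(f)\equiv f^q \pmod \pi$ for all $f$. For rational $b$ and $c$ put $L(b,c)=\{\sum a_uX^u\in A_0:\operatorname{ord}_\pi a_u\ge b|u|+c \text{ for all } u\}$. Let $I$ be a countable (possibly finite) set, $M=\prod_{i\in I}A_0e_i$ with the product topology, and $M^*=\operatorname{Hom}^{\rm cont}_{A_0}(M,\Omega^nA_0)$ with the norm $\|f\|=\max_{m\in M}\|f(m)\|$, where $\Omega^nA_0=A_0\,dX_1\wedge\dots\wedge dX_n$. Its elements are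 the sums $\sum_j a_je_j^*$ with $a_j\in A_0$, $\|a_j\|\to0$, where $e_j^*(e_i)=\delta_{ij}\,dX_1\wedge\dots\wedge dX_n$. Let $M^*(b,c)$ be the set of those with all $a_j\in L(b,c)$. A *Dwork operator* on $M^*$ is a continuous $R$-linear map $\Theta:M^*\to M^*$ with $\Theta(\sigma(a)f)=a\,\Theta(f)$ for $a\in A_0$, $f\in M^*$. Write $\Theta(X^ve_{j_2}^*)=\sum_{u,j_1}G^*_{(u,j_1),(v,j_2)}X^ue_{j_1}^*$. * $\Theta$ is *nuclear* if $\lim_{j_1\to\infty}\inf_{j_2}\operatorname{ord}_\pi G^*_{(u,j_1),(v,j_2)}=\infty$ for all fixed $u,v$. * $\Theta$ is *contracting* if there are rational $b>0$, $c$, $c_1$ with $\Theta(M^*(b,c))\subset M^*(qb,c+c_1)$; we then call $b$ *admissible* for $\Theta$. * For an $R$-linear endomorphism $L$ of $M^*$, $\|L\|=p^{-i}$ with $i$ the largest integer such that $L(M^*)\subset\pi^iM^*$ (and $\|L\|=0$ if there is no largest one). * A family $(\Theta_k)_{k\in S}$ of Dwork operators on $M^*$, $S$ a uniform space, is *uniform*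 if $\lim_{j_1\to\infty}\inf_{j_2,k}\operatorname{ord}_\pi G^*_{(u,j_1),(v,j_2)}(k)=\infty$ for all fixed $u,v$, and the contracting condition holds for all $\Theta_k$ with the same $b,c,c_1$ (so every $\Theta_k$ is nuclear and contracting). It is *uniformly continuous* if $\|\Theta_{k_1}-\Theta_{k_2}\|$ is uniformly small whenever $k_1$ is close to $k_2$. For a matrix $G=(G_{r,s})_{r,s\in J}$ over $K$, $\det(I-TG)=\sum_{m\ge0}(-1)^mT^m\sum_{|S|=m}\det\big((G_{r,s})_{r,s\in S}\big)$, where $S$ runs over the $m$-element subsets of $J$, if these sums converge. $G$ is *completely continuous* if its entries are bounded and for every $C>0$ all but finitely many rows have all their entries of order at least $C$. The norm of a power series in $R[[T]]$ is the maximum of the absolute values of its coefficients. A family $f(k,T)=\sum_m f_m(k)T^m$, $f_0(k)=1$, $f_m(k)\in R$, is *uniformly entire* if $\lim_{m\to\infty}\inf_k\operatorname{ord}_\pi f_m(k)/m=\infty$, and *uniformly continuous* if $\|f(k_1,T)-f(k_2,T)\|$ is uniformly small whenever $k_1$ is close to $k_2$. **Theorem.** (1) Let $\Theta$ be a nuclear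 contracting Dwork operator on $M^*$. For every admissible $b$, $\Theta$ induces a continuous endomorphism of $M^*(b,0)\otimes K$; its matrix $G$ with respect to the topological basis $\{\pi^{\lceil b|u|\rceil}X^ue_j^*\}$ is completely continuous, the sums that define $\det(I-TG)$ converge, and $\det(I-TG)$ does not depend on the admissible $b$. So the Fredholm determinant $\det(I-T\Theta):=\det(I-TG)$ is well defined. It has constant term $1$ and coefficients in $R$, and it is $p$-adic entire: $\operatorname{ord}_\pi(\text{coefficient of }T^m)/m\to\infty$ as $m\to\infty$. (2) Let $(\Theta_k)_{k\in S}$ be a uniform family of Dwork operators on $M^*$. Then the family $\det(I-T\Theta_k)$ is uniformly entire, and for all $k_1,k_2\in S$ $$\|\det(I-T\Theta_{k_1})-\det(I-T\Theta_{k_2})\|\le\|\Theta_{k_1}-\Theta_{k_2}\|.$$ If moreover $(\Theta_k)$ is uniformly continuous in $k$, then so is the family $\det(I-T\Theta_k)$. -/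

import Mathlib

open Filter Topology

namespace Dwork

section Ring

variable (K : Type*) [NontriviallyNormedField K] [IsUltrametricDist K]

/-- The ring of integers `R = {x ∈ K : |x| ≤ 1}` of `K`. -/
noncomputable abbrev OK : ValuationSubring K := (NormedField.valuation (K := K)).valuationSubring

/-- The number `q` of elements of the residue field of `R`. -/
noncomputable def resCard : ℕ := Nat.card (IsLocalRing.ResidueField (OK K))

/-- The ring `A₀` of convergent power series in `n` variables over `R`: those whose coefficients
tend to zero. -/
noncomputable def A0.subalgebra (n : ℕ) : Subalgebra (OK K) (MvPowerSeries (Fin n) (OK K)) where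
  carrier := {f | MvPowerSeries.IsRestricted (fun _ => 1) f}
  add_mem' := MvPowerSeries.isRestricted.add _
  mul_mem' := MvPowerSeries.isRestricted.mul _
  algebraMap_mem' a := MvPowerSeries.isRestricted_C _ a

/-- The ring `A₀` as a type. -/
def A0 (n : ℕ) : Type _ := A0.subalgebra K n

noncomputable instance (n : ℕ) : CommRing (A0 K n) :=
  inferInstanceAs (CommRing (A0.subalgebra K n))

noncomputable instance (n : ℕ) : Algebra (OK K) (A0 K n) :=
  inferInstanceAs (Algebra (OK K) (A0.subalgebra K n))

variable {K}

/-- `ord_π a ≥ t`, where `|a| = p ^ (-ord_π a)`. -/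
def OrdGe (p : ℕ) (a : K) (t : ℝ) : Prop := ‖a‖ ≤ (p : ℝ) ^ (-t)

variable {n : ℕ}

/-- The coefficient of `X ^ u`. -/
noncomputable def A0.coeff (u : Fin n →₀ ℕ) (f : A0 K n) : OK K :=
  MvPowerSeries.coeff u f.1

theorem A0.coeff_zero (u : Fin n →₀ ℕ) : (0 : A0 K n).coeff u = 0 := rfl

theorem A0.coeff_add (u : Fin n →₀ ℕ) (f g : A0 K n) :
    (f + g).coeff u = f.coeff u + g.coeff u := rfl

theorem A0.coeff_mul [DecidableEq (Fin n)] (u : Fin n →₀ ℕ) (f g : A0 K n) :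
    (f * g).coeff u = ∑ x ∈ Finset.HasAntidiagonal.antidiagonal u, f.coeff x.1 * g.coeff x.2 :=
  MvPowerSeries.coeff_mul u f.1 g.1

/-- The Gauss norm on `A₀`. -/
noncomputable def A0.gaussNorm (f : A0 K n) : ℝ := ⨆ u, ‖(f.coeff u : K)‖

/-- The monomial `X ^ u`. -/
noncomputable def A0.X (u : Fin n →₀ ℕ) : A0 K n :=
  ⟨MvPowerSeries.monomial u 1, MvPowerSeries.isRestricted_monomial _ u 1⟩

/-- Membership in the overconvergent subring `A` of `A₀`: `liminf ord_π a_u / |u| > 0`. -/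
def A0.IsOverconvergent (p : ℕ) (f : A0 K n) : Prop :=
  ∃ b : ℝ, 0 < b ∧ ∀ᶠ u in cofinite, OrdGe p (f.coeff u : K) (b * Finsupp.degree u)

/-- Membership in `L(b, c)`: `ord_π a_u ≥ b |u| + c` for all `u`. -/
def A0.InL (p : ℕ) (b c : ℚ) (f : A0 K n) : Prop :=
  ∀ u, OrdGe p (f.coeff u : K) ((b : ℝ) * Finsupp.degree u + c)

theorem norm_int_le (a : OK K) : ‖(a : K)‖ ≤ 1 := by
  have h := a.2
  rw [Valuation.mem_valuationSubring_iff, NormedField.valuation_apply] at h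
  exact_mod_cast h

theorem A0.norm_coeff_le (f : A0 K n) (u : Fin n →₀ ℕ) : ‖(f.coeff u : K)‖ ≤ f.gaussNorm :=
  le_ciSup (f := fun u => ‖(f.coeff u : K)‖)
    ⟨1, by rintro _ ⟨v, rfl⟩; exact norm_int_le _⟩ u

theorem A0.gaussNorm_le {f : A0 K n} {C : ℝ} (h : ∀ u, ‖(f.coeff u : K)‖ ≤ C) :
    f.gaussNorm ≤ C := ciSup_le h

theorem A0.gaussNorm_nonneg (f : A0 K n) : 0 ≤ f.gaussNorm :=
  (norm_nonneg _).trans (f.norm_coeff_le 0)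

theorem A0.gaussNorm_zero : (0 : A0 K n).gaussNorm = 0 :=
  le_antisymm (A0.gaussNorm_le fun u => by simp [A0.coeff_zero]) (A0.gaussNorm_nonneg _)

theorem A0.gaussNorm_add_le (f g : A0 K n) :
    (f + g).gaussNorm ≤ max f.gaussNorm g.gaussNorm :=
  A0.gaussNorm_le fun u => by
    have : ((f + g).coeff u : K) = (f.coeff u : K) + (g.coeff u : K) := by simp [A0.coeff_add]
    rw [this]
    exact (IsUltrametricDist.norm_add_le_max _ _).trans
      (max_le_max (f.norm_coeff_le u) (g.norm_coeff_le u))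

theorem A0.gaussNorm_mul_le (f g : A0 K n) : (f * g).gaussNorm ≤ g.gaussNorm :=
  A0.gaussNorm_le fun u => by
    classical
    have : ((f * g).coeff u : K) = ∑ x ∈ Finset.HasAntidiagonal.antidiagonal u,
        (f.coeff x.1 : K) * (g.coeff x.2 : K) := by
      simp [A0.coeff_mul]
    rw [this]
    refine IsUltrametricDist.norm_sum_le_of_forall_le_of_nonneg g.gaussNorm_nonneg
      fun x _ => ?_
    rw [norm_mul]
    exact (mul_le_of_le_one_left (norm_nonneg _) (norm_int_le _)).trans (g.norm_coeff_le _)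

/-- A lifting `σ` of the `q`-th power Frobenius map: an `R`-algebra endomorphism of `A₀` which
maps the overconvergent subring `A` to itself and reduces to `f ↦ f ^ q` modulo `π`. -/
structure FrobeniusLift (p : ℕ) (π : OK K) (n : ℕ) where
  toAlgHom : A0 K n →ₐ[OK K] A0 K n
  overconvergent : ∀ f : A0 K n, f.IsOverconvergent p → (toAlgHom f).IsOverconvergent p
  lifts : ∀ f : A0 K n, ∃ g : A0 K n, toAlgHom f = f ^ resCard K + π • g

end Ring

section Module

variable (K : Type*) [NontriviallyNormedField K] [IsUltrametricDist K] (n : ℕ) (I : Type*)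

/-- `M* = Hom^cont(M, Ωⁿ A₀)`, where `M = b(I)` is the module of all families `(a_i)`, `a_i ∈ A₀`,
with the product topology, and the free module `Ωⁿ A₀` of rank one is identified with `A₀`
through its generator `dX_1 ∧ ⋯ ∧ dX_n`. The condition is continuity at the origin. -/
def MStar.submodule : Submodule (A0 K n) ((I → A0 K n) →ₗ[A0 K n] A0 K n) where
  carrier := {f | ∀ ε : ℝ, 0 < ε → ∃ s : Finset I, ∃ δ : ℝ, 0 < δ ∧
    ∀ m : I → A0 K n, (∀ i ∈ s, (m i).gaussNorm < δ) → (f m).gaussNorm < ε}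
  zero_mem' ε hε := ⟨∅, 1, one_pos, fun m _ => by
    simpa [A0.gaussNorm_zero] using hε⟩
  add_mem' {f g} hf hg ε hε := by
    classical
    obtain ⟨s, δ, hδ, h⟩ := hf ε hε
    obtain ⟨s', δ', hδ', h'⟩ := hg ε hε
    refine ⟨s ∪ s', min δ δ', lt_min hδ hδ', fun m hm => ?_⟩
    refine (A0.gaussNorm_add_le (f m) (g m)).trans_lt (max_lt (h m fun i hi => ?_)
      (h' m fun i hi => ?_))
    · exact (hm i (Finset.mem_union_left _ hi)).trans_le (min_le_left _ _)
    · exact (hm i (Finset.mem_union_right _ hi)).trans_le (min_le_right _ _)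
  smul_mem' a f hf ε hε := by
    obtain ⟨s, δ, hδ, h⟩ := hf ε hε
    exact ⟨s, δ, hδ, fun m hm => (A0.gaussNorm_mul_le a (f m)).trans_lt (h m hm)⟩

/-- The module `M*` as a type. -/
def MStar : Type _ := MStar.submodule K n I

noncomputable instance : AddCommGroup (MStar K n I) :=
  inferInstanceAs (AddCommGroup (MStar.submodule K n I))

noncomputable instance : Module (A0 K n) (MStar K n I) :=
  inferInstanceAs (Module (A0 K n) (MStar.submodule K n I))

/-- `R` acts on `M*` through `R → A₀`. -/
noncomputable instance : Module (OK K) (MStar K n I) :=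
  Module.compHom (MStar K n I) (algebraMap (OK K) (A0 K n))

variable {K n I}

/-- The norm `‖f‖ = max_m ‖f(m)‖` on `M*`. -/
noncomputable def MStar.norm (f : MStar K n I) : ℝ :=
  ⨆ m : I → A0 K n, (f.1 m).gaussNorm

/-- The dual basis element `e_j*`, which takes `e_j` to the generator of `Ωⁿ A₀` and the other
`e_i` to zero. -/
noncomputable def MStar.e (j : I) : MStar K n I :=
  ⟨LinearMap.proj j, fun ε hε => ⟨{j}, ε, hε, fun m hm => hm j (by simp)⟩⟩

open Classical in
/-- The coefficient `a_j ∈ A₀` in the expansion `f = ∑ a_j e_j*`; it is `f(e_j)`. -/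
noncomputable def MStar.comp (j : I) (f : MStar K n I) : A0 K n := f.1 (Pi.single j 1)

/-- The coefficient of `X ^ u e_j*` in the expansion of `f ∈ M*`. -/
noncomputable def MStar.coord (r : (Fin n →₀ ℕ) × I) (f : MStar K n I) : OK K :=
  (f.comp r.2).coeff r.1

/-- Membership in `M*(b, c)`: `f = ∑ a_j e_j*` with all `a_j` in `L(b, c)`. (The condition
`‖a_j‖ → 0` holds for every element of `M*`.) -/
def MStar.InL (p : ℕ) (b c : ℚ) (f : MStar K n I) : Prop := ∀ j, (f.comp j).InL p b c

/-- The element `X ^ v e_j*` of `M*`. -/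
noncomputable def MStar.mon (s : (Fin n →₀ ℕ) × I) : MStar K n I :=
  (A0.X s.1 : A0 K n) • (MStar.e s.2 : MStar K n I)

/-- The operator norm `‖L‖ = p ^ (-ord_π L)`, with `ord_π L` the largest `i` such that
`L(M*) ⊆ π ^ i M*` (and `‖L‖ = 0` if there is no largest one). -/
noncomputable def opNorm (p : ℕ) (π : OK K) (L : MStar K n I →ₗ[OK K] MStar K n I) : ℝ :=
  sInf {r : ℝ | ∃ i : ℕ, (∀ f, ∃ g, L f = π ^ i • g) ∧ r = ((p : ℝ)⁻¹) ^ i}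

/-- A Dwork operator on `M*`: a continuous, `R`-linear and `σ⁻¹`-linear endomorphism. -/
structure DworkOperator {p : ℕ} {π : OK K} (σ : FrobeniusLift p π n) (I : Type*) where
  toLin : MStar K n I →ₗ[OK K] MStar K n I
  continuous : ∀ ε : ℝ, 0 < ε → ∃ δ : ℝ, 0 < δ ∧
    ∀ f : MStar K n I, f.norm < δ → (toLin f).norm < ε
  semilinear : ∀ (a : A0 K n) (f : MStar K n I), toLin (σ.toAlgHom a • f) = a • toLin f

end Module

section Fredholm

variable {K : Type*} [NontriviallyNormedField K] {J : Type*}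

/-- Complete continuity of an infinite matrix in the sense of Serre: its entries are bounded and
its rows tend uniformly to zero. -/
def IsCompletelyContinuous (G : Matrix J J K) : Prop :=
  (∃ B : ℝ, ∀ r s, ‖G r s‖ ≤ B) ∧ ∀ ε : ℝ, 0 < ε → {r | ∃ s, ε < ‖G r s‖}.Finite

open Classical in
/-- The principal minor of `G` with index set `S`. -/
noncomputable def minor (G : Matrix J J K) (S : Finset J) : K :=
  (G.submatrix (fun i : S => (i : J)) (fun i : S => (i : J))).det

/-- The Fredholm determinant `det(I - T G)`: the coefficient of `T ^ m` is `(-1) ^ m` times the sum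
of all principal `m × m` minors. -/
noncomputable def fredholmDet (G : Matrix J J K) : PowerSeries K :=
  PowerSeries.mk fun m => (-1) ^ m * ∑' S : {S : Finset J // S.card = m}, minor G S

/-- The sums which define the coefficients of `det(I - T G)` converge. -/
def FredholmConverges (G : Matrix J J K) : Prop :=
  ∀ m : ℕ, Summable fun S : {S : Finset J // S.card = m} => minor G S

/-- `F` has constant term `1` and coefficients in `R`. -/
def IsIntegral (F : PowerSeries K) : Prop :=
  PowerSeries.coeff 0 F = 1 ∧ ∀ m, ‖PowerSeries.coeff m F‖ ≤ 1

/-- A family `f(k, T)` is uniformly entire: `inf_k ord_π f_m(k) / m → ∞`. -/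
def UniformlyEntire (p : ℕ) {S : Type*} (F : S → PowerSeries K) : Prop :=
  ∀ C : ℝ, ∀ᶠ m : ℕ in atTop, ∀ k, OrdGe p (PowerSeries.coeff m (F k)) (C * m)

/-- A single power series is entire: `ord_π f_m / m → ∞`. -/
def IsEntire (p : ℕ) (F : PowerSeries K) : Prop :=
  ∀ C : ℝ, ∀ᶠ m : ℕ in atTop, OrdGe p (PowerSeries.coeff m F) (C * m)

/-- The Gauss norm of a power series with bounded coefficients. -/
noncomputable def seriesNorm (F : PowerSeries K) : ℝ := ⨆ m, ‖PowerSeries.coeff m F‖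

end Fredholm

/-- A distance `d(k₁, k₂)` is uniformly small whenever `k₁` is close to `k₂`. -/
def UniformlySmall {S : Type*} [UniformSpace S] (d : S → S → ℝ) : Prop :=
  ∀ ε : ℝ, 0 < ε → ∃ V ∈ uniformity S, ∀ k₁ k₂, (k₁, k₂) ∈ V → d k₁ k₂ < ε

namespace DworkOperator

variable {K : Type*} [NontriviallyNormedField K] [IsUltrametricDist K] {n : ℕ} {I : Type*}
  {p : ℕ} {π : OK K} {σ : FrobeniusLift p π n}

/-- The coefficient `G*_{r, s}` of `X ^ u e_{j₁}*` in `Θ(X ^ v e_{j₂}*)`, for `r = (u, j₁)` and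
`s = (v, j₂)`. -/
noncomputable def Gstar (Θ : DworkOperator σ I) (r s : (Fin n →₀ ℕ) × I) : OK K :=
  (Θ.toLin (MStar.mon s)).coord r

/-- The nuclear condition: `lim_{j₁} inf_{j₂} ord_π G*_{(u, j₁), (v, j₂)} = ∞` for all `u`, `v`. -/
def IsNuclear (Θ : DworkOperator σ I) : Prop :=
  ∀ (u v : Fin n →₀ ℕ) (C : ℝ), ∀ᶠ j₁ in cofinite, ∀ j₂,
    OrdGe p (Θ.Gstar (u, j₁) (v, j₂) : K) C

/-- `Θ(M*(b, c)) ⊆ M*(qb, c + c₁)`. -/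
def ContractsWith (Θ : DworkOperator σ I) (b c c₁ : ℚ) : Prop :=
  ∀ f : MStar K n I, f.InL p b c → (Θ.toLin f).InL p (resCard K * b) (c + c₁)

/-- `b > 0` satisfies the contracting condition for suitable `c` and `c₁`. -/
def ContractsAt (Θ : DworkOperator σ I) (b : ℚ) : Prop :=
  0 < b ∧ ∃ c c₁ : ℚ, Θ.ContractsWith b c c₁

/-- Contracting Dwork operators. -/
def IsContracting (Θ : DworkOperator σ I) : Prop := ∃ b : ℚ, Θ.ContractsAt b

/-- `Θ` induces a continuous endomorphism of the `K`-Banach space `M*(b, 0) ⊗ K`. -/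
def ActsOn (Θ : DworkOperator σ I) (b : ℚ) : Prop :=
  ∃ k : ℕ, ∀ f : MStar K n I, f.InL p b 0 → (π ^ k • Θ.toLin f).InL p b 0

/-- The matrix `G` of `Θ` acting on `M*(b, 0) ⊗ K`, with respect to the topological basis
`π ^ ⌈b |u|⌉ X ^ u e_j*`. The entry at `(r, s)` is the coordinate with index `r` of the image of
the basis element with index `s`. -/
noncomputable def matrix (Θ : DworkOperator σ I) (b : ℚ) :
    Matrix ((Fin n →₀ ℕ) × I) ((Fin n →₀ ℕ) × I) K := fun r s =>
  ((Θ.toLin (π ^ ⌈b * s.1.degree⌉₊ • MStar.mon s)).coord r : K) / (π : K) ^ ⌈b * r.1.degree⌉₊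

/-- The Fredholm determinant `det(I - TΘ | M*)` of a contracting Dwork operator, computed on
`M*(b, 0) ⊗ K` for some `b` which satisfies the contracting condition. -/
noncomputable def det (Θ : DworkOperator σ I) (h : Θ.IsContracting) : PowerSeries K :=
  fredholmDet (Θ.matrix h.choose)

/-- A uniform family of nuclear contracting Dwork operators: the nuclear condition holds uniformly
in `k`, and the contracting condition holds with constants independent of `k`. -/
structure IsUniform {S : Type*} (Θ : S → DworkOperator σ I) : Prop where
  nuclear : ∀ (u v : Fin n →₀ ℕ) (C : ℝ), ∀ᶠ j₁ in cofinite, ∀ j₂ k,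
    OrdGe p ((Θ k).Gstar (u, j₁) (v, j₂) : K) C
  contracting : ∃ b c c₁ : ℚ, 0 < b ∧ ∀ k, (Θ k).ContractsWith b c c₁

theorem IsUniform.isContracting {S : Type*} {Θ : S → DworkOperator σ I} (h : IsUniform Θ) (k : S) :
    (Θ k).IsContracting := by
  obtain ⟨b, c, c₁, hb, h⟩ := h.contracting
  exact ⟨b, hb, c, c₁, h k⟩

end DworkOperator

end Dwork

/-! Two matrices represent Θ. The matrix `Gstar` on the monomials X^u e_j* has entries in R, but its
rows need not tend to zero. The matrix on M*(b,0) ⊗ K is its conjugate by the diagonal matrix with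
entries π^⌈b|u|⌉, and for admissible b it is completely continuous. Conjugation fixes every
principal minor (`minor_eq_of_diagonal_conj`), so each property can be read off the better matrix:
convergence and entireness from the conjugate, integrality, independence of b and the Lipschitz
bound from `Gstar`.

Complete continuity combines two facts. Contraction gives ord G*_{(u,j₁),(v,j₂)} ≥ qb|u| - b|v| +
const, and conjugation turns this into (q-1)b|u| + const, uniformly in the column, so rows of large
|u| are small. For the finitely many remaining u, columns of large |v| are made small by the factor
π^⌈b|v|⌉, and nuclearity handles the finitely many remaining v (`exists_finset_norm_matrix_le`). An
m × m minor is at most the product of its row bounds, and only a bounded number of rows are not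
small; hence entireness. All constants are uniform in a uniform family. -/

namespace Dwork

/-! ### Ultrametric bounds for minors and Fredholm determinants -/

section FredholmEstimates

variable {K : Type*} [NontriviallyNormedField K] {J : Type*}

/-- Principal minors are unchanged by conjugation with an invertible diagonal matrix. -/
theorem minor_eq_of_diagonal_conj {G H : Matrix J J K} {d : J → K} (hd : ∀ r, d r ≠ 0)
    (h : ∀ r s, H r s = d s * G r s / d r) (S : Finset J) : minor H S = minor G S := by
  classical
  unfold minor
  have : H.submatrix (fun i : S => (i : J)) (fun i : S => (i : J)) =
      Matrix.diagonal (fun i : S => (d i)⁻¹) *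
        (G.submatrix (fun i : S => (i : J)) (fun i : S => (i : J))) *
          Matrix.diagonal (fun i : S => d i) := by
    ext i j
    simp only [Matrix.submatrix_apply, Matrix.mul_diagonal, Matrix.diagonal_mul, h]
    ring
  rw [this, Matrix.det_mul, Matrix.det_mul, Matrix.det_diagonal, Matrix.det_diagonal,
    mul_right_comm, ← Finset.prod_mul_distrib]
  simp [hd]

theorem coeff_zero_fredholmDet (G : Matrix J J K) : PowerSeries.coeff 0 (fredholmDet G) = 1 := by
  classical
  rw [fredholmDet, PowerSeries.coeff_mk, tsum_eq_single ⟨∅, rfl⟩]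
  · simp [minor]
  · rintro ⟨S, hS⟩ h
    exact absurd (Subtype.ext (Finset.card_eq_zero.1 hS)) h

variable [IsUltrametricDist K]

/-- Each Leibniz term uses one entry from every row, and the ultrametric inequality costs no
factorial. -/
theorem norm_det_le_prod {ι : Type*} [Fintype ι] [DecidableEq ι] (A : Matrix ι ι K) {ρ : ι → ℝ}
    (h : ∀ i j, ‖A i j‖ ≤ ρ i) : ‖A.det‖ ≤ ∏ i, ρ i := by
  have hρ : ∀ i, 0 ≤ ρ i := fun i => (norm_nonneg _).trans (h i i)
  -- Transposing indexes the factors of each Leibniz term by rows, so the row bounds apply factor by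
  -- factor.
  rw [← Matrix.det_transpose, Matrix.det_apply']
  refine IsUltrametricDist.norm_sum_le_of_forall_le_of_nonneg
    (Finset.prod_nonneg fun i _ => hρ i) fun τ _ => ?_
  rw [norm_mul, norm_prod]
  have hs : ‖((Equiv.Perm.sign τ : ℤ) : K)‖ = 1 := by
    rcases Int.units_eq_one_or (Equiv.Perm.sign τ) with e | e <;> simp [e]
  rw [hs, one_mul]
  exact Finset.prod_le_prod (fun _ _ => norm_nonneg _) fun i _ => h i _

theorem norm_minor_le_prod (G : Matrix J J K) {ρ : J → ℝ} (h : ∀ r s, ‖G r s‖ ≤ ρ r)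
    (S : Finset J) : ‖minor G S‖ ≤ ∏ r ∈ S, ρ r := by
  classical
  rw [← Finset.prod_coe_sort]
  exact norm_det_le_prod _ fun i j => h _ _

theorem norm_minor_le_one {G : Matrix J J K} (h : ∀ r s, ‖G r s‖ ≤ 1) (S : Finset J) :
    ‖minor G S‖ ≤ 1 :=
  (norm_minor_le_prod G h S).trans (by simp)

/-- Replace the factors one at a time: each replacement costs at most ε because all other factors
lie in the unit ball. -/
theorem norm_prod_sub_prod_le {ι : Type*} (s : Finset ι) {f g : ι → K} {ε : ℝ} (hε : 0 ≤ ε)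
    (hf : ∀ i, ‖f i‖ ≤ 1) (hg : ∀ i, ‖g i‖ ≤ 1) (h : ∀ i, ‖f i - g i‖ ≤ ε) :
    ‖∏ i ∈ s, f i - ∏ i ∈ s, g i‖ ≤ ε := by
  classical
  induction s using Finset.induction_on with
  | empty => simpa using hε
  | insert a s ha ih =>
    rw [Finset.prod_insert ha, Finset.prod_insert ha]
    have e : f a * ∏ i ∈ s, f i - g a * ∏ i ∈ s, g i =
        f a * (∏ i ∈ s, f i - ∏ i ∈ s, g i) + (f a - g a) * ∏ i ∈ s, g i := by ring
    rw [e]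
    refine (IsUltrametricDist.norm_add_le_max _ _).trans (max_le ?_ ?_)
    · rw [norm_mul]
      exact (mul_le_of_le_one_left (norm_nonneg _) (hf a)).trans ih
    · rw [norm_mul, norm_prod]
      exact (mul_le_of_le_one_right (norm_nonneg _)
        (Finset.prod_le_one (fun _ _ => norm_nonneg _) fun i _ => hg i)).trans (h a)

theorem norm_minor_sub_minor_le {G H : Matrix J J K} {ε : ℝ} (hε : 0 ≤ ε)
    (hG : ∀ r s, ‖G r s‖ ≤ 1) (hH : ∀ r s, ‖H r s‖ ≤ 1) (h : ∀ r s, ‖G r s - H r s‖ ≤ ε)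
    (S : Finset J) : ‖minor G S - minor H S‖ ≤ ε := by
  classical
  unfold minor
  rw [Matrix.det_apply', Matrix.det_apply', ← Finset.sum_sub_distrib]
  refine IsUltrametricDist.norm_sum_le_of_forall_le_of_nonneg hε fun τ _ => ?_
  have hs : ‖((Equiv.Perm.sign τ : ℤ) : K)‖ = 1 := by
    rcases Int.units_eq_one_or (Equiv.Perm.sign τ) with e | e <;> simp [e]
  rw [← mul_sub, norm_mul, hs, one_mul]
  exact norm_prod_sub_prod_le _ hε (fun _ => hG _ _) (fun _ => hH _ _) fun _ => h _ _

theorem norm_coeff_fredholmDet_le {G : Matrix J J K} {m : ℕ} {C : ℝ} (hC : 0 ≤ C)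
    (h : ∀ S : Finset J, S.card = m → ‖minor G S‖ ≤ C) :
    ‖PowerSeries.coeff m (fredholmDet G)‖ ≤ C := by
  rw [fredholmDet, PowerSeries.coeff_mk, norm_mul, norm_pow, norm_neg, norm_one, one_pow, one_mul]
  -- No convergence is needed: a divergent `tsum` is 0, which 0 ≤ C covers.
  exact IsUltrametricDist.norm_tsum_le_of_forall_le_of_nonneg hC fun S => h S S.2

theorem isIntegral_fredholmDet {G : Matrix J J K} (h : ∀ r s, ‖G r s‖ ≤ 1) :
    IsIntegral (fredholmDet G) :=
  ⟨coeff_zero_fredholmDet G, fun _ =>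
    norm_coeff_fredholmDet_le zero_le_one fun S _ => norm_minor_le_one h S⟩

theorem seriesNorm_fredholmDet_sub_le {G H : Matrix J J K} (cG : FredholmConverges G)
    (cH : FredholmConverges H) {ε : ℝ} (hε : 0 ≤ ε)
    (hG : ∀ r s, ‖G r s‖ ≤ 1) (hH : ∀ r s, ‖H r s‖ ≤ 1) (h : ∀ r s, ‖G r s - H r s‖ ≤ ε) :
    seriesNorm (fredholmDet G - fredholmDet H) ≤ ε := by
  refine ciSup_le fun m => ?_
  rw [map_sub, fredholmDet, fredholmDet, PowerSeries.coeff_mk, PowerSeries.coeff_mk, ← mul_sub,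
    norm_mul, norm_pow, norm_neg, norm_one, one_pow, one_mul, ← (cG m).tsum_sub (cH m)]
  exact IsUltrametricDist.norm_tsum_le_of_forall_le_of_nonneg hε fun S =>
    norm_minor_sub_minor_le hε hG hH h S

/-- The Fredholm determinant of a completely continuous matrix converges. -/
theorem IsCompletelyContinuous.fredholmConverges [CompleteSpace K] {G : Matrix J J K}
    (hG : IsCompletelyContinuous G) : FredholmConverges G := by
  classical
  intro m
  obtain ⟨⟨B₀, hB₀⟩, hrow⟩ := hG
  obtain ⟨B, hB, hB1⟩ : ∃ B : ℝ, (∀ r s, ‖G r s‖ ≤ B) ∧ 1 ≤ B :=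
    ⟨max B₀ 1, fun r s => (hB₀ r s).trans (le_max_left _ _), le_max_right _ _⟩
  refine NonarchimedeanAddGroup.summable_of_tendsto_cofinite_zero ?_
  rw [NormedAddGroup.tendsto_nhds_zero]
  intro ε hε
  have hBm : 0 < B ^ m := by positivity
  -- A minor that meets a row bounded by δ is at most δ * B ^ m = ε / 2; the bound 1 ≤ B absorbs the
  -- missing power of B. So only subsets of the finite set `F` of remaining rows can have a minor of
  -- norm at least ε.
  set δ : ℝ := ε / (2 * B ^ m) with hδ
  have hδ0 : 0 < δ := by positivity
  set F : Finset J := (hrow δ hδ0).toFinset with hF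
  have hFr : ∀ r ∉ F, ∀ s, ‖G r s‖ ≤ δ := fun r hr s => by
    by_contra! hlt
    exact hr (by simpa [hF] using ⟨s, hlt⟩)
  refine Set.Finite.subset (((insert ∅ F.powerset).finite_toSet).preimage
    Subtype.val_injective.injOn) fun S hS => ?_
  by_contra hSF
  simp only [Finset.coe_insert, Set.mem_preimage, Set.mem_insert_iff, Finset.mem_coe,
    Finset.mem_powerset, not_or] at hSF
  obtain ⟨r, hrS, hrF⟩ := Finset.not_subset.1 hSF.2
  refine hS ?_
  have hle := norm_minor_le_prod G (ρ := fun i => if i = r then δ else B) (fun i s => by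
    by_cases hi : i = r
    · simpa [hi] using hFr r hrF s
    · simpa [hi] using hB i s) S
  rw [← Finset.mul_prod_erase _ _ hrS] at hle
  have he : ∏ i ∈ S.1.erase r, (if i = r then δ else B) ≤ B ^ m := by
    rw [Finset.prod_congr rfl (g := fun _ => B) fun i hi => if_neg (Finset.ne_of_mem_erase hi),
      Finset.prod_const]
    exact pow_le_pow_right₀ hB1 ((Finset.card_le_card (Finset.erase_subset _ _)).trans_eq S.2)
  calc ‖minor G S‖ ≤ δ * B ^ m := by
        refine hle.trans ?_
        simpa using mul_le_mul_of_nonneg_left he hδ0.le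
    _ = ε / 2 := by rw [hδ]; field_simp
    _ < ε := half_lt_self hε

/-- The Fredholm determinants of a family of bounded matrices, the rows of which tend to zero
uniformly in the family, are uniformly entire. -/
theorem uniformlyEntire_fredholmDet {p : ℕ} (hp : 1 < p) {T : Type*} {G : T → Matrix J J K}
    (hbdd : ∃ B : ℝ, ∀ k r s, ‖G k r s‖ ≤ B)
    (hrow : ∀ ε : ℝ, 0 < ε → ∃ F : Finset J, ∀ k, ∀ r ∉ F, ∀ s, ‖G k r s‖ ≤ ε) :
    UniformlyEntire p fun k => fredholmDet (G k) := by
  classical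
  have hp1 : (1 : ℝ) < p := by exact_mod_cast hp
  have hp0 : (0 : ℝ) < p := zero_lt_one.trans hp1
  intro C
  obtain ⟨B₀, hB₀⟩ := hbdd
  -- The extra 1 leaves a spare factor p^(-m), which for large m beats the constant (B / ε)^|F| due
  -- to the exceptional rows.
  set ε : ℝ := (p : ℝ) ^ (-(C + 1)) with hε
  have hε0 : 0 < ε := Real.rpow_pos_of_pos hp0 _
  obtain ⟨B, hB, hBε⟩ : ∃ B : ℝ, (∀ k r s, ‖G k r s‖ ≤ B) ∧ ε ≤ B :=
    ⟨max B₀ ε, fun k r s => (hB₀ k r s).trans (le_max_left _ _), le_max_right _ _⟩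
  obtain ⟨F, hF⟩ := hrow ε hε0
  have hBε1 : 1 ≤ B / ε := (one_le_div hε0).2 hBε
  filter_upwards [(tendsto_pow_atTop_atTop_of_one_lt hp1).eventually_ge_atTop
    ((B / ε) ^ F.card)] with m hm k
  refine norm_coeff_fredholmDet_le (Real.rpow_nonneg hp0.le _) fun S hS => ?_
  -- Writing B as ε * (B / ε) extracts ε^m; at most |F| factors B / ε remain, whatever m is.
  have hle := norm_minor_le_prod (G k) (ρ := fun i => ε * if i ∈ F then B / ε else 1)
    (fun i s => by
      by_cases hi : i ∈ F
      · simpa [hi, mul_div_cancel₀ _ hε0.ne'] using hB k i s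
      · simpa [hi] using hF k i hi s) S
  rw [Finset.prod_mul_distrib, Finset.prod_const, hS, Finset.prod_ite, Finset.prod_const_one,
    mul_one, Finset.prod_const] at hle
  have hcard : (S.filter (· ∈ F)).card ≤ F.card :=
    Finset.card_le_card fun i hi => (Finset.mem_filter.1 hi).2
  calc ‖minor (G k) S‖ ≤ ε ^ m * (p : ℝ) ^ m :=
        hle.trans (mul_le_mul_of_nonneg_left ((pow_le_pow_right₀ hBε1 hcard).trans hm) (by positivity))
    _ = (p : ℝ) ^ (-(C * m)) := by
        rw [hε, ← Real.rpow_natCast, ← Real.rpow_natCast, ← Real.rpow_mul hp0.le,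
          ← Real.rpow_add hp0]
        congr 1
        ring

end FredholmEstimates

end Dwork

namespace Dwork

/-! ### Calculus of orders -/

section OrdGe

variable {K : Type*} [NontriviallyNormedField K] {p : ℕ} {a : K} {s t : ℝ}

theorem OrdGe.mono (hp : 1 < p) (h : OrdGe p a t) (hst : s ≤ t) : OrdGe p a s :=
  h.trans (Real.rpow_le_rpow_of_exponent_le (by exact_mod_cast hp.le) (neg_le_neg hst))

theorem OrdGe.mul {b : K} (hp : 1 < p) (ha : OrdGe p a s) (hb : OrdGe p b t) :
    OrdGe p (a * b) (s + t) := by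
  have hp0 : (0 : ℝ) < p := by exact_mod_cast zero_lt_one.trans hp
  unfold OrdGe at *
  rw [norm_mul, neg_add, Real.rpow_add hp0]
  exact mul_le_mul ha hb (norm_nonneg _) (Real.rpow_nonneg hp0.le _)

theorem ordGe_zero (p : ℕ) (t : ℝ) : OrdGe p (0 : K) t := by
  unfold OrdGe
  rw [norm_zero]
  positivity

theorem ordGe_pow {π : K} (hπ : ‖π‖ = (p : ℝ)⁻¹) (m : ℕ) : OrdGe p (π ^ m) m := by
  unfold OrdGe
  rw [norm_pow, hπ, Real.rpow_neg (Nat.cast_nonneg _), Real.rpow_natCast, inv_pow]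

/-- Divisibility by `π ^ m` lowers the order by exactly `m`. -/
theorem ordGe_pow_mul_iff {π : K} (hp : 1 < p) (hπ : ‖π‖ = (p : ℝ)⁻¹) (m : ℕ) :
    OrdGe p (π ^ m * a) t ↔ OrdGe p a (t - m) := by
  have hp0 : (0 : ℝ) < p := by exact_mod_cast zero_lt_one.trans hp
  unfold OrdGe
  rw [norm_mul, norm_pow, hπ, inv_pow, inv_mul_le_iff₀ (by positivity), neg_sub, sub_eq_add_neg,
    Real.rpow_add hp0, Real.rpow_natCast]

theorem OrdGe.div_pow {π : K} (hp : 1 < p) (hπ : ‖π‖ = (p : ℝ)⁻¹) (m : ℕ) (h : OrdGe p a t) :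
    OrdGe p (a / π ^ m) (t - m) := by
  have hp0 : (0 : ℝ) < p := by exact_mod_cast zero_lt_one.trans hp
  have hπ0 : π ≠ 0 := by
    rintro rfl
    rw [norm_zero] at hπ
    exact (inv_pos.2 hp0).ne hπ
  rw [← ordGe_pow_mul_iff hp hπ, mul_div_cancel₀ _ (pow_ne_zero _ hπ0)]
  exact h

/-- The powers of `p` are cofinal: every positive `ε` bounds the elements of large order. -/
theorem exists_ordGe_norm_le (hp : 1 < p) {ε : ℝ} (hε : 0 < ε) :
    ∃ t : ℝ, ∀ {K : Type*} [NontriviallyNormedField K] (a : K), OrdGe p a t → ‖a‖ ≤ ε := by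
  have hp1 : (1 : ℝ) < p := by exact_mod_cast hp
  refine ⟨-Real.logb p ε, fun a h => h.trans_eq ?_⟩
  rw [neg_neg, Real.rpow_logb (zero_lt_one.trans hp1) hp1.ne' hε]

end OrdGe

theorem ordGe_int {K : Type*} [NontriviallyNormedField K] [IsUltrametricDist K] {p : ℕ} (a : OK K) :
    OrdGe p (a : K) 0 := by
  simpa [OrdGe] using norm_int_le a

/-! ### Coordinates on M* and the lattices M*(b, c) -/

section Coordinates

variable {K : Type*} [NontriviallyNormedField K] [IsUltrametricDist K] {n : ℕ} {I : Type*}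

theorem MStar.coord_smul (a : OK K) (f : MStar K n I) (r : (Fin n →₀ ℕ) × I) :
    (a • f).coord r = a * f.coord r := by
  change MvPowerSeries.coeff r.1 ((algebraMap (OK K) (MvPowerSeries (Fin n) (OK K)) a) *
    (f.comp r.2).1) = _
  rw [MvPowerSeries.algebraMap_apply, Algebra.algebraMap_self_apply, MvPowerSeries.coeff_C_mul]
  rfl

theorem MStar.coord_sub (f g : MStar K n I) (r : (Fin n →₀ ℕ) × I) :
    (f - g).coord r = f.coord r - g.coord r :=
  map_sub (MvPowerSeries.coeff (R := OK K) r.1) (f.comp r.2).1 (g.comp r.2).1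

theorem MStar.coord_mon_of_ne {r s : (Fin n →₀ ℕ) × I} (h : r ≠ s) :
    (MStar.mon s : MStar K n I).coord r = 0 := by
  classical
  have hc : (MStar.mon s : MStar K n I).comp r.2 =
      A0.X s.1 * (Pi.single r.2 (1 : A0 K n) : I → A0 K n) s.2 := by
    unfold MStar.comp
    change A0.X s.1 * _ = _
    congr!
  unfold MStar.coord
  rw [hc]
  by_cases h2 : s.2 = r.2
  · rw [h2, Pi.single_eq_same, mul_one]
    exact MvPowerSeries.coeff_monomial_ne (fun h1 => h (Prod.ext h1 h2.symm)) 1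
  · rw [Pi.single_eq_of_ne h2, mul_zero]
    rfl

theorem MStar.inL_iff {p : ℕ} {b c : ℚ} {f : MStar K n I} :
    f.InL p b c ↔ ∀ r, OrdGe p (f.coord r : K) ((b : ℝ) * r.1.degree + c) :=
  ⟨fun h r => h r.2 r.1, fun h j u => h (u, j)⟩

/-- Scaling shifts c and leaves b alone, so by linearity the contracting condition can be applied
after multiplying by a power of π and the power removed afterwards. -/
theorem MStar.pow_smul_inL_iff {p : ℕ} (hp : 1 < p) {π : OK K} (hπ : ‖(π : K)‖ = (p : ℝ)⁻¹) (m : ℕ)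
    {b c : ℚ} {f : MStar K n I} : (π ^ m • f).InL p b c ↔ f.InL p b (c - m) := by
  simp only [MStar.inL_iff, MStar.coord_smul, MulMemClass.coe_mul, SubmonoidClass.coe_pow,
    ordGe_pow_mul_iff hp hπ]
  push_cast
  simp only [add_sub_assoc]

theorem MStar.InL.mono {p : ℕ} (hp : 1 < p) {b b' c c' : ℚ} {f : MStar K n I} (h : f.InL p b c)
    (hb : b' ≤ b) (hc : c' ≤ c) : f.InL p b' c' := fun j u => by
  refine (h j u).mono hp ?_
  have : (b' : ℝ) ≤ b := by exact_mod_cast hb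
  have : (c' : ℝ) ≤ c := by exact_mod_cast hc
  gcongr

theorem MStar.pow_smul_mon_inL {p : ℕ} (hp : 1 < p) {π : OK K} (hπ : ‖(π : K)‖ = (p : ℝ)⁻¹) {m : ℕ}
    {b c : ℚ} {s : (Fin n →₀ ℕ) × I} (h : (b : ℝ) * s.1.degree + c ≤ m) :
    (π ^ m • (MStar.mon s : MStar K n I)).InL p b c := by
  rw [MStar.inL_iff]
  intro r
  rw [MStar.coord_smul]
  by_cases hr : r = s
  · subst hr
    have := (ordGe_pow (K := K) hπ m).mul hp (ordGe_int ((MStar.mon r : MStar K n I).coord r))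
    refine OrdGe.mono hp (by simpa using this) h
  · rw [MStar.coord_mon_of_ne hr, mul_zero]
    exact ordGe_zero p _

end Coordinates

/-! ### The matrices of a Dwork operator -/

namespace DworkOperator

variable {K : Type*} [NontriviallyNormedField K] [IsUltrametricDist K] {n : ℕ} {I : Type*}
  {p : ℕ} {π : OK K} {σ : FrobeniusLift p π n}

theorem matrix_eq (Θ : DworkOperator σ I) (b : ℚ) (r s : (Fin n →₀ ℕ) × I) :
    Θ.matrix b r s =
      (π : K) ^ ⌈b * s.1.degree⌉₊ * (Θ.Gstar r s : K) / (π : K) ^ ⌈b * r.1.degree⌉₊ := by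
  rw [matrix, map_smul, MStar.coord_smul]
  rfl

theorem minor_matrix (hπ : (π : K) ≠ 0) (Θ : DworkOperator σ I) (b : ℚ)
    (S : Finset ((Fin n →₀ ℕ) × I)) :
    minor (Θ.matrix b) S = minor (fun r s => (Θ.Gstar r s : K)) S :=
  minor_eq_of_diagonal_conj (d := fun r => (π : K) ^ ⌈b * r.1.degree⌉₊)
    (fun _ => pow_ne_zero _ hπ) (Θ.matrix_eq b) S

/-- On `M*(b, 0) ⊗ K` the Fredholm determinant is that of the matrix `G*`. -/
theorem fredholmDet_matrix (hπ : (π : K) ≠ 0) (Θ : DworkOperator σ I) (b : ℚ) :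
    fredholmDet (Θ.matrix b) = fredholmDet fun r s => (Θ.Gstar r s : K) := by
  simp only [fredholmDet, Θ.minor_matrix hπ]

theorem fredholmConverges_matrix_iff (hπ : (π : K) ≠ 0) (Θ : DworkOperator σ I) (b : ℚ) :
    FredholmConverges (Θ.matrix b) ↔ FredholmConverges fun r s => (Θ.Gstar r s : K) := by
  simp only [FredholmConverges, Θ.minor_matrix hπ]

theorem Gstar_sub_eq {Θ Θ' : DworkOperator σ I} {i : ℕ}
    (h : ∀ f, ∃ g, (Θ.toLin - Θ'.toLin) f = π ^ i • g) (r s : (Fin n →₀ ℕ) × I) :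
    ∃ a : OK K, (Θ.Gstar r s : K) - Θ'.Gstar r s = (π : K) ^ i * a := by
  obtain ⟨g, hg⟩ := h (MStar.mon s)
  refine ⟨g.coord r, ?_⟩
  have := congrArg (MStar.coord r) hg
  rw [LinearMap.sub_apply, MStar.coord_sub, MStar.coord_smul] at this
  simpa [Gstar] using congrArg (Subtype.val) this

theorem ordGe_matrix (hp : 1 < p) (hπ : ‖(π : K)‖ = (p : ℝ)⁻¹) {Θ : DworkOperator σ I} {b : ℚ}
    {r s : (Fin n →₀ ℕ) × I} {t : ℝ} (h : OrdGe p (Θ.Gstar r s : K) t) :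
    OrdGe p (Θ.matrix b r s) (⌈b * s.1.degree⌉₊ + t - ⌈b * r.1.degree⌉₊) := by
  rw [matrix_eq]
  exact ((ordGe_pow hπ _).mul hp h).div_pow hp hπ _

/-- Scale X^v e_j* by the power π^m that puts it into M*(b, c), apply Θ, and divide by π^m again. -/
theorem ContractsWith.ordGe_Gstar (hp : 1 < p) (hπ : ‖(π : K)‖ = (p : ℝ)⁻¹)
    {Θ : DworkOperator σ I} {b c c₁ : ℚ} (h : Θ.ContractsWith b c c₁) (hb : 0 < b)
    (r s : (Fin n →₀ ℕ) × I) :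
    OrdGe p (Θ.Gstar r s : K)
      ((resCard K : ℝ) * b * r.1.degree - b * s.1.degree + (c + c₁ - |(c : ℝ)| - 1)) := by
  have hbs : (0 : ℝ) ≤ b * s.1.degree := by positivity
  -- With |c| in place of c the argument is nonnegative, so the natural ceiling overshoots by less
  -- than 1.
  set m : ℕ := ⌈(b : ℝ) * s.1.degree + |(c : ℝ)|⌉₊ with hm
  have hm1 : (b : ℝ) * s.1.degree + |(c : ℝ)| ≤ m := Nat.le_ceil _
  have hm2 : (m : ℝ) < b * s.1.degree + |(c : ℝ)| + 1 := Nat.ceil_lt_add_one (by positivity)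
  have h1 := h _ (MStar.pow_smul_mon_inL (s := s) hp hπ
    (((add_le_add_iff_left _).2 (le_abs_self _)).trans hm1))
  rw [map_smul, MStar.pow_smul_inL_iff hp hπ, MStar.inL_iff] at h1
  refine (h1 r).mono hp ?_
  push_cast
  linarith

theorem one_lt_resCard [IsDiscreteValuationRing (OK K)]
    [Finite (IsLocalRing.ResidueField (OK K))] : 1 < resCard K :=
  Finite.one_lt_card

theorem ContractsWith.actsOn (hp : 1 < p) (hπ : ‖(π : K)‖ = (p : ℝ)⁻¹) (hq : 1 ≤ resCard K)
    {Θ : DworkOperator σ I} {b c c₁ : ℚ} (h : Θ.ContractsWith b c c₁) (hb : 0 < b) :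
    Θ.ActsOn b := by
  -- π^m carries M*(b, 0) into M*(b, c); k then absorbs the remaining deficit m - (c + c₁), and qb ≥
  -- b.
  obtain ⟨m, hm⟩ := exists_nat_ge c
  obtain ⟨k, hk⟩ := exists_nat_ge (m - (c + c₁))
  refine ⟨k, fun f hf => ?_⟩
  have h1 : (π ^ m • f).InL p b c := by
    rw [MStar.pow_smul_inL_iff hp hπ]
    exact hf.mono hp le_rfl (by linarith)
  have h2 := h _ h1
  rw [map_smul, MStar.pow_smul_inL_iff hp hπ] at h2
  rw [MStar.pow_smul_inL_iff hp hπ]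
  refine h2.mono hp (le_mul_of_one_le_left hb.le (by exact_mod_cast hq)) (by linarith)

/-- The column factor cancels -b|v|, and the row factor costs less than b|u| + 1, leaving a bound
free of the column. The 2 collects two roundings: this one and the one in
`ContractsWith.ordGe_Gstar`. -/
theorem ordGe_matrix_of_contractsWith (hp : 1 < p) (hπ : ‖(π : K)‖ = (p : ℝ)⁻¹)
    {Θ : DworkOperator σ I} {b c c₁ : ℚ} (h : Θ.ContractsWith b c c₁) (hb : 0 < b)
    (r s : (Fin n →₀ ℕ) × I) :
    OrdGe p (Θ.matrix b r s)
      (((resCard K : ℝ) - 1) * b * r.1.degree + (c + c₁ - |(c : ℝ)| - 2)) := by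
  refine (ordGe_matrix hp hπ (h.ordGe_Gstar hp hπ hb r s)).mono hp ?_
  have h1 : ((b * s.1.degree : ℚ) : ℝ) ≤ (⌈b * s.1.degree⌉₊ : ℝ) := by
    exact_mod_cast Nat.le_ceil (b * s.1.degree)
  have h2 : (⌈b * r.1.degree⌉₊ : ℝ) < ((b * r.1.degree + 1 : ℚ) : ℝ) := by
    exact_mod_cast Nat.ceil_lt_add_one (by positivity : 0 ≤ b * (r.1.degree : ℚ))
  push_cast at h1 h2
  linarith

/-! ### Uniform families -/

variable {T : Type*} {Θ : T → DworkOperator σ I}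

theorem exists_norm_matrix_le (hp : 1 < p) (hπ : ‖(π : K)‖ = (p : ℝ)⁻¹) (hq : 1 ≤ resCard K)
    {b c c₁ : ℚ} (hb : 0 < b) (h : ∀ k, (Θ k).ContractsWith b c c₁) :
    ∃ B : ℝ, ∀ k r s, ‖(Θ k).matrix b r s‖ ≤ B := by
  refine ⟨_, fun k r s => (ordGe_matrix_of_contractsWith hp hπ (h k) hb r s).mono hp
    (s := c + c₁ - |(c : ℝ)| - 2) ?_⟩
  have hq' : (0 : ℝ) ≤ (resCard K : ℝ) - 1 := sub_nonneg.2 (by exact_mod_cast hq)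
  exact le_add_of_nonneg_left (by positivity)

/-- For a uniform family the rows of the matrices tend to zero uniformly. -/
theorem exists_finset_norm_matrix_le (hp : 1 < p) (hπ : ‖(π : K)‖ = (p : ℝ)⁻¹) (hq : 1 < resCard K)
    {b c c₁ : ℚ} (hb : 0 < b) (h : ∀ k, (Θ k).ContractsWith b c c₁)
    (hnuc : ∀ (u v : Fin n →₀ ℕ) (C : ℝ), ∀ᶠ j₁ in cofinite, ∀ j₂ k,
      OrdGe p ((Θ k).Gstar (u, j₁) (v, j₂) : K) C) {ε : ℝ} (hε : 0 < ε) :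
    ∃ F : Finset ((Fin n →₀ ℕ) × I), ∀ k, ∀ r ∉ F, ∀ s, ‖(Θ k).matrix b r s‖ ≤ ε := by
  classical
  obtain ⟨t, ht⟩ := exists_ordGe_norm_le hp hε
  have hbR : (0 : ℝ) < b := by exact_mod_cast hb
  have hqb : (0 : ℝ) < ((resCard K : ℝ) - 1) * b :=
    mul_pos (sub_pos.2 (by exact_mod_cast hq)) hbR
  -- Beyond degree d contraction alone gives order t; this uses q > 1.
  obtain ⟨d, hd⟩ := exists_nat_ge ((t - (c + c₁ - |(c : ℝ)| - 2)) / (((resCard K : ℝ) - 1) * b))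
  rw [div_le_iff₀ hqb] at hd
  -- For |u| ≤ d, dividing by π^⌈b|u|⌉ loses at most bd + 1. A column of degree beyond d' makes up
  -- for this loss by its own factor, using only that `Gstar` is integral.
  obtain ⟨d', hd'⟩ := exists_nat_ge ((t + b * d + 1) / b)
  rw [div_le_iff₀ hbR] at hd'
  have hceil (u : Fin n →₀ ℕ) (hu : u.degree ≤ d) : (⌈b * u.degree⌉₊ : ℝ) ≤ b * d + 1 := by
    have h2 : (⌈b * u.degree⌉₊ : ℝ) < ((b * u.degree + 1 : ℚ) : ℝ) := by
      exact_mod_cast Nat.ceil_lt_add_one (by positivity : 0 ≤ b * (u.degree : ℚ))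
    have h3 : (b : ℝ) * u.degree ≤ b * d := by gcongr
    push_cast at h2
    linarith
  -- Nuclearity is not uniform in u and v, but only finitely many pairs are left.
  have hev : ∀ᶠ j₁ in cofinite, ∀ u ∈ {u : Fin n →₀ ℕ | u.degree ≤ d},
      ∀ v ∈ {v : Fin n →₀ ℕ | v.degree ≤ d'}, ∀ j₂ k,
        OrdGe p ((Θ k).Gstar (u, j₁) (v, j₂) : K) (t + b * d + 1) :=
    (Finsupp.finite_of_degree_le d).eventually_all.2 fun u _ =>
      (Finsupp.finite_of_degree_le d').eventually_all.2 fun v _ => hnuc u v _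
  refine ⟨(Finsupp.finite_of_degree_le d).toFinset ×ˢ (Filter.eventually_cofinite.1 hev).toFinset,
    fun k ⟨u, j₁⟩ hr ⟨v, j₂⟩ => ht _ ?_⟩
  by_cases hu : u.degree ≤ d
  · have hj : ∀ u ∈ {u : Fin n →₀ ℕ | u.degree ≤ d},
        ∀ v ∈ {v : Fin n →₀ ℕ | v.degree ≤ d'}, ∀ j₂ k,
          OrdGe p ((Θ k).Gstar (u, j₁) (v, j₂) : K) (t + b * d + 1) := by
      by_contra hj
      exact hr (Finset.mem_product.2
        ⟨(Set.Finite.mem_toFinset _).2 hu, (Set.Finite.mem_toFinset _).2 hj⟩)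
    have hc := hceil u hu
    by_cases hv : v.degree ≤ d'
    · refine (ordGe_matrix hp hπ (hj u hu v hv j₂ k)).mono hp ?_
      have : (0 : ℝ) ≤ ⌈b * v.degree⌉₊ := Nat.cast_nonneg _
      simp only
      linarith
    · refine (ordGe_matrix hp hπ (ordGe_int _)).mono hp ?_
      have h1 : ((b * v.degree : ℚ) : ℝ) ≤ (⌈b * v.degree⌉₊ : ℝ) := by
        exact_mod_cast Nat.le_ceil (b * v.degree)
      have h2 : (d' : ℝ) * b ≤ v.degree * b := by
        have : (d' : ℝ) ≤ v.degree := by exact_mod_cast (not_le.1 hv).le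
        gcongr
      push_cast at h1
      simp only
      linarith
  · refine (ordGe_matrix_of_contractsWith hp hπ (h k) hb _ _).mono hp ?_
    have : (d : ℝ) * (((resCard K : ℝ) - 1) * b) ≤ u.degree * (((resCard K : ℝ) - 1) * b) := by
      have : (d : ℝ) ≤ u.degree := by exact_mod_cast (not_le.1 hu).le
      gcongr
    simp only
    linarith

theorem isCompletelyContinuous_matrix (hp : 1 < p) (hπ : ‖(π : K)‖ = (p : ℝ)⁻¹)
    (hq : 1 < resCard K) {Θ : DworkOperator σ I} (hnuc : Θ.IsNuclear) {b : ℚ}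
    (h : Θ.ContractsAt b) : IsCompletelyContinuous (Θ.matrix b) := by
  obtain ⟨hb, c, c₁, h⟩ := h
  obtain ⟨B, hB⟩ := exists_norm_matrix_le (Θ := fun _ : Unit => Θ) hp hπ hq.le hb fun _ => h
  refine ⟨⟨B, hB ()⟩, fun ε hε => ?_⟩
  obtain ⟨F, hF⟩ := exists_finset_norm_matrix_le (Θ := fun _ : Unit => Θ) hp hπ hq hb (fun _ => h)
    (fun u v C => (hnuc u v C).mono fun j₁ hj j₂ _ => hj j₂) hε
  refine F.finite_toSet.subset fun r ⟨s, hs⟩ => ?_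
  by_contra hr
  exact (hF () r hr s).not_gt hs

theorem IsUniform.isNuclear (h : IsUniform Θ) (k : T) : (Θ k).IsNuclear :=
  fun u v C => (h.nuclear u v C).mono fun _ hj j₂ => hj j₂ k

/-- The estimates use the common b, whereas `det` chooses some b for each member; passing through
`Gstar` makes the choices irrelevant. -/
theorem IsUniform.uniformlyEntire (hp : 1 < p) (hπ : ‖(π : K)‖ = (p : ℝ)⁻¹) (hπ0 : (π : K) ≠ 0)
    (hq : 1 < resCard K) (h : IsUniform Θ) :
    UniformlyEntire p fun k => fredholmDet fun r s => ((Θ k).Gstar r s : K) := by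
  obtain ⟨b, c, c₁, hb, hc⟩ := h.contracting
  have := uniformlyEntire_fredholmDet hp (exists_norm_matrix_le hp hπ hq.le hb hc)
    fun ε hε => exists_finset_norm_matrix_le hp hπ hq hb hc h.nuclear hε
  simpa only [fredholmDet_matrix hπ0] using this

theorem fredholmConverges_Gstar [CompleteSpace K] (hp : 1 < p) (hπ : ‖(π : K)‖ = (p : ℝ)⁻¹)
    (hπ0 : (π : K) ≠ 0) (hq : 1 < resCard K) {Θ : DworkOperator σ I} (hnuc : Θ.IsNuclear)
    (h : Θ.IsContracting) : FredholmConverges fun r s => (Θ.Gstar r s : K) := by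
  obtain ⟨b, hb⟩ := h
  exact (Θ.fredholmConverges_matrix_iff hπ0 b).1
    (isCompletelyContinuous_matrix hp hπ hq hnuc hb).fredholmConverges

/-- Divisibility of Θ - Θ' by π^i passes to the entries of `Gstar` without loss; conjugated entries
carry unbounded denominators, so the comparison is made before conjugating. -/
theorem seriesNorm_sub_le_opNorm (hπ : ‖(π : K)‖ = (p : ℝ)⁻¹) {Θ Θ' : DworkOperator σ I}
    (c : FredholmConverges fun r s => (Θ.Gstar r s : K))
    (c' : FredholmConverges fun r s => (Θ'.Gstar r s : K)) :
    seriesNorm ((fredholmDet fun r s => (Θ.Gstar r s : K)) -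
      fredholmDet fun r s => (Θ'.Gstar r s : K)) ≤ opNorm p π (Θ.toLin - Θ'.toLin) := by
  -- The exponent i = 0 always qualifies, so the infimum is over a nonempty set.
  refine le_csInf ⟨_, 0, fun f => ⟨(Θ.toLin - Θ'.toLin) f, ?_⟩, rfl⟩ ?_
  · rw [pow_zero, one_smul]
  rintro _ ⟨i, hi, rfl⟩
  refine seriesNorm_fredholmDet_sub_le c c' (by positivity) (fun _ _ => norm_int_le _)
    (fun _ _ => norm_int_le _) fun r s => ?_
  obtain ⟨a, ha⟩ := Gstar_sub_eq hi r s
  rw [ha, norm_mul, norm_pow, hπ]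
  exact mul_le_of_le_one_right (by positivity) (norm_int_le a)

end DworkOperator

end Dwork

/-! ### The theorem -/

open Dwork in
theorem theorem1p6 {K : Type*} [NontriviallyNormedField K] [IsUltrametricDist K] [CompleteSpace K]
    [CharZero K] [IsDiscreteValuationRing (Dwork.OK K)]
    [Finite (IsLocalRing.ResidueField (Dwork.OK K))]
    (p : ℕ) [Fact p.Prime] [CharP (IsLocalRing.ResidueField (Dwork.OK K)) p]
    (π : Dwork.OK K) (hπ : Irreducible π) (hnorm : ‖(π : K)‖ = (p : ℝ)⁻¹)
    (n : ℕ) (hn : 0 < n) (σ : FrobeniusLift p π n) (I : Type*) [Countable I] :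
    (∀ (Θ : DworkOperator σ I) (_ : Θ.IsNuclear) (hΘ : Θ.IsContracting),
      (∀ b : ℚ, Θ.ContractsAt b →
        Θ.ActsOn b ∧ IsCompletelyContinuous (Θ.matrix b) ∧ FredholmConverges (Θ.matrix b) ∧
          fredholmDet (Θ.matrix b) = Θ.det hΘ) ∧
      IsIntegral (Θ.det hΘ) ∧ IsEntire p (Θ.det hΘ)) ∧
    (∀ (S : Type*) [UniformSpace S] (Θ : S → DworkOperator σ I) (hΘ : DworkOperator.IsUniform Θ),
      UniformlyEntire p (fun k => (Θ k).det (hΘ.isContracting k)) ∧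
      (∀ k₁ k₂, seriesNorm ((Θ k₁).det (hΘ.isContracting k₁) - (Θ k₂).det (hΘ.isContracting k₂)) ≤
        opNorm p π ((Θ k₁).toLin - (Θ k₂).toLin)) ∧
      (UniformlySmall (fun k₁ k₂ => opNorm p π ((Θ k₁).toLin - (Θ k₂).toLin)) →
        UniformlySmall (fun k₁ k₂ => seriesNorm
          ((Θ k₁).det (hΘ.isContracting k₁) - (Θ k₂).det (hΘ.isContracting k₂))))) := by
  have hp : 1 < p := (Fact.out : p.Prime).one_lt
  have hq : 1 < resCard K := DworkOperator.one_lt_resCard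
  have hπ0 : (π : K) ≠ 0 := fun h => hπ.ne_zero (Subtype.ext h)
  refine ⟨fun Θ hnuc hΘ => ⟨fun b hb => ⟨?_, ?_, ?_, ?_⟩, ?_, ?_⟩, fun S _ Θ hΘ => ?_⟩
  · obtain ⟨hb0, c, c₁, h⟩ := hb
    exact h.actsOn hp hnorm hq.le hb0
  · exact DworkOperator.isCompletelyContinuous_matrix hp hnorm hq hnuc hb
  · exact (DworkOperator.isCompletelyContinuous_matrix hp hnorm hq hnuc hb).fredholmConverges
  · rw [DworkOperator.det, Θ.fredholmDet_matrix hπ0, Θ.fredholmDet_matrix hπ0]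
  · rw [DworkOperator.det, Θ.fredholmDet_matrix hπ0]
    exact isIntegral_fredholmDet fun _ _ => norm_int_le _
  · rw [DworkOperator.det, Θ.fredholmDet_matrix hπ0]
    obtain ⟨b, hb, c, c₁, h⟩ := hΘ
    -- A single operator is treated as a family with one member.
    have hu : DworkOperator.IsUniform fun _ : Unit => Θ :=
      ⟨fun u v C => (hnuc u v C).mono fun _ hj j₂ _ => hj j₂, b, c, c₁, hb, fun _ => h⟩
    exact fun C => (hu.uniformlyEntire hp hnorm hπ0 hq C).mono fun m hm => hm ()
  · have hle : ∀ k₁ k₂, seriesNorm ((Θ k₁).det (hΘ.isContracting k₁) -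
        (Θ k₂).det (hΘ.isContracting k₂)) ≤ opNorm p π ((Θ k₁).toLin - (Θ k₂).toLin) := by
      intro k₁ k₂
      rw [DworkOperator.det, DworkOperator.det, (Θ k₁).fredholmDet_matrix hπ0,
        (Θ k₂).fredholmDet_matrix hπ0]
      have hc := fun k => DworkOperator.fredholmConverges_Gstar hp hnorm hπ0 hq (hΘ.isNuclear k)
        (hΘ.isContracting k)
      exact DworkOperator.seriesNorm_sub_le_opNorm hnorm (hc k₁) (hc k₂)
    refine ⟨?_, hle, fun h ε hε => ?_⟩
    · simpa only [DworkOperator.det, DworkOperator.fredholmDet_matrix hπ0] using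
        hΘ.uniformlyEntire hp hnorm hπ0 hq
    · obtain ⟨V, hV, hVε⟩ := h ε hε
      exact ⟨V, hV, fun k₁ k₂ hk => (hle k₁ k₂).trans_lt (hVε k₁ k₂ hk)⟩
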